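/- **Setting.** Let $D\subset\mathbb R^n$ be open, let $f\colon D\to\mathbb R^n$ be of class $C^2$, and assume that $\dot x=f(x)$ generates a flow $\phi\colon\mathbb R\times D\to D$; that is, for every $x\in D$ the solution $\phi(t,x)$ with $\phi(0,x)=x$ exists in $D$ for all $t\in\mathbb R$. Write $x\preceq y$ if $y-x\in\mathbb R^n_{\ge0}$, and $v\succ 0$ if $0\preceq v\neq 0$. Let $x^*\in D$ be a stable hyperbolic fixed point, i.e. $f(x^*)=0$ and all eigenvalues of the Jacobian matrix $J(x^*)$ have negative real part, and let $J(x^*)$ be diagonalizable over $\mathbb C$. Let $\mathcal B=\{x\in D:\lim_{t\to\infty}\phi(t,x)=x^*\}$ be the basin of attraction. Let $\lambda_1$ be the dominant eigenvalue of $J(x^*)$, i.e. $\Re\lambda_1>\Re\lambda$ for every other eigenvalue $\lambda\ne\lambda_1$ (the multiplicity of $\lambda_1$ is arbitrary). Let $s_1\in C^1(\mathcal B)$ be a real-valued dominant Koopman eigenfunction: $s_1\not\equiv0$ and $s_1(\phi(t,x))=e^{\lambda_1t}s_1(x)$ for all $x\in\mathcal B$, $t\ge0$, normalized by $v_1^T\nabla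 s_1(x^*)=1$ for some right eigenvector $v_1\succ0$ of $J(x^*)$ for $\lambda_1$. Its zero isostable is $\partial\mathcal B_0=\{x\in\mathcal B: s_1(x)=0\}$. **Definitions.** For a function $V$, let $\dot V(x)=\frac{d}{dt}V(\phi(t,x))\big|_{t=0}$. A function $W$ is a *Lyapunov function on* $X\subset\mathcal B$ if $W\in C^1(X)$, $W(x^*)=0$, and $W(x)>0$ and $\dot W(x)<0$ for all $x\in X\setminus\{x^*\}$. A function $V\colon\mathbb R^n\to\mathbb R\cup\{+\infty\}$ is a *maximal Lyapunov function* if 1. $V(x^*)=0$ and $V(x)>0$ for all $x\in\mathcal B\setminus\{x^*\}$; 2. $V(x)<\infty$ if and only if $x\in\mathcal B$; 3. $V(x)\to\infty$ as $x$ tends to any point of $\partial\mathcal B$, and $V(x)\to\infty$ as $\|x\|\to\infty$; 4. $\dot V(x)$ exists for all $x\in\mathcal B$, and $\dot V(x)<0$ for all $x\in\mathcal B\setminus\{x^*\}$. **Proposition.** Assume that the system is monotone on $\mathcal B$, i.e. $\phi(t,x)\preceq\phi(t,y)$ for all $t\ge0$ and all $x\preceq y$ in $\mathcal B$, and that $\partial\mathcal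 B_0\cap(x^*+\mathbb R^n_{\ge0})=\{x^*\}$. Then $s_1$ is a Lyapunov function on $X=(x^*+\mathbb R^n_{\ge0})\cap\mathcal B$. Moreover, there is a maximal Lyapunov function $V\colon\mathbb R^n\to\mathbb R\cup\{+\infty\}$ with $V=s_1$ on $X$. -/

import Mathlib

open Set Filter Topology
open scoped Pointwise

namespace MonotoneKoopman

/-- `φ` is the (complete) flow of `ẋ = f(x)` on the state space `D`: for every `x ∈ D` the curve
`t ↦ φ t x`, `t ∈ ℝ`, is a solution in `D` with initial value `x`. -/
structure IsFlowOn {n : ℕ} (f : (Fin n → ℝ) → (Fin n → ℝ)) (D : Set (Fin n → ℝ))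
    (φ : ℝ → (Fin n → ℝ) → (Fin n → ℝ)) : Prop where
  init : ∀ x ∈ D, φ 0 x = x
  mem : ∀ x ∈ D, ∀ t : ℝ, φ t x ∈ D
  hasDerivAt : ∀ x ∈ D, ∀ t : ℝ, HasDerivAt (fun τ => φ τ x) (f (φ t x)) t

/-- The basin of attraction of `xs`. -/
def basin {n : ℕ} (D : Set (Fin n → ℝ)) (φ : ℝ → (Fin n → ℝ) → (Fin n → ℝ))
    (xs : Fin n → ℝ) : Set (Fin n → ℝ) :=
  {x | x ∈ D ∧ Tendsto (fun t => φ t x) atTop (𝓝 xs)}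

/-- The Jacobian matrix of `f` at `x`, with its entries regarded as complex numbers. -/
noncomputable def jacobian {n : ℕ} (f : (Fin n → ℝ) → (Fin n → ℝ)) (x : Fin n → ℝ) :
    Matrix (Fin n) (Fin n) ℂ :=
  Matrix.of fun i j => ((fderiv ℝ f x (Pi.single j 1) i : ℝ) : ℂ)

/-- `xs` is a stable hyperbolic fixed point of `ẋ = f(x)`: all eigenvalues of the Jacobian matrix
have negative real part. -/
def IsStableHyperbolic {n : ℕ} (f : (Fin n → ℝ) → (Fin n → ℝ)) (xs : Fin n → ℝ) : Prop :=
  f xs = 0 ∧ ∀ μ ∈ spectrum ℂ (jacobian f xs), μ.re < 0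

/-- The complex matrix `A` is diagonalizable: it has a basis of eigenvectors. -/
def IsDiagonalizable {n : ℕ} (A : Matrix (Fin n) (Fin n) ℂ) : Prop :=
  ∃ b : Module.Basis (Fin n) ℂ (Fin n → ℂ), ∀ i, ∃ μ : ℂ, A.mulVec (b i) = μ • b i

/-- `lam` is an eigenvalue of `A` whose real part is larger than that of every other eigenvalue.
Its multiplicity is not restricted. -/
def IsDominantEigenvalue {n : ℕ} (A : Matrix (Fin n) (Fin n) ℂ) (lam : ℂ) : Prop :=
  lam ∈ spectrum ℂ A ∧ ∀ μ ∈ spectrum ℂ A, μ ≠ lam → μ.re < lam.re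

/-- The Koopman semigroup `U^t g = g ∘ φ(t, ·)`. -/
def koopman {n : ℕ} (φ : ℝ → (Fin n → ℝ) → (Fin n → ℝ)) (t : ℝ)
    (g : (Fin n → ℝ) → ℂ) : (Fin n → ℝ) → ℂ :=
  fun x => g (φ t x)

/-- `g` is a (nontrivial) Koopman eigenfunction on `B` with Koopman eigenvalue `lam`. -/
def IsKoopmanEigenfunction {n : ℕ} (φ : ℝ → (Fin n → ℝ) → (Fin n → ℝ)) (B : Set (Fin n → ℝ))
    (lam : ℂ) (g : (Fin n → ℝ) → ℂ) : Prop :=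
  (∃ x ∈ B, g x ≠ 0) ∧
    ∀ t : ℝ, 0 ≤ t → ∀ x ∈ B, koopman φ t g x = g x * Complex.exp (lam * t)

/-- `s` is a real dominant eigenfunction of class `C¹` on `B` for the eigenvalue `lam`, normalized by
`vᵀ ∇s(xs) = 1` for a right eigenvector `v ≻ 0` of the Jacobian matrix (`0 < v` means that `v` is
entrywise nonnegative and nonzero). -/
structure IsDominantEigenfunction {n : ℕ} (f : (Fin n → ℝ) → (Fin n → ℝ))
    (φ : ℝ → (Fin n → ℝ) → (Fin n → ℝ)) (xs : Fin n → ℝ) (B : Set (Fin n → ℝ))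
    (lam : ℂ) (v : Fin n → ℝ) (s : (Fin n → ℝ) → ℝ) : Prop where
  dominant : IsDominantEigenvalue (jacobian f xs) lam
  eigenvector : (jacobian f xs).mulVec (fun i => (v i : ℂ)) = lam • (fun i => (v i : ℂ))
  pos : 0 < v
  contDiffOn : ContDiffOn ℝ 1 s B
  eigenfunction : IsKoopmanEigenfunction φ B lam (fun x => (s x : ℂ))
  normalized : fderiv ℝ s xs v = 1

/-- The flow is monotone on `A` for the entrywise order. -/
def IsMonotoneFlowOn {n : ℕ} (φ : ℝ → (Fin n → ℝ) → (Fin n → ℝ)) (A : Set (Fin n → ℝ)) : Prop :=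
  ∀ t : ℝ, 0 ≤ t → ∀ x ∈ A, ∀ y ∈ A, x ≤ y → φ t x ≤ φ t y

/-- The isostable `∂B_α = {x ∈ B | |s x| = α}`. -/
def isostable {n : ℕ} (s : (Fin n → ℝ) → ℝ) (B : Set (Fin n → ℝ)) (α : ℝ) : Set (Fin n → ℝ) :=
  {x | x ∈ B ∧ |s x| = α}

/-- `d` is the derivative `V̇(x)` of `V` along the flow. -/
def HasOrbitalDeriv {n : ℕ} (φ : ℝ → (Fin n → ℝ) → (Fin n → ℝ)) (V : (Fin n → ℝ) → ℝ)
    (x : Fin n → ℝ) (d : ℝ) : Prop :=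
  HasDerivAt (fun t => V (φ t x)) d 0

/-- `W` is a Lyapunov function on `X` for the fixed point `xs`. -/
structure IsLyapunovOn {n : ℕ} (φ : ℝ → (Fin n → ℝ) → (Fin n → ℝ)) (xs : Fin n → ℝ)
    (X : Set (Fin n → ℝ)) (W : (Fin n → ℝ) → ℝ) : Prop where
  contDiffOn : ContDiffOn ℝ 1 W X
  zero : W xs = 0
  pos : ∀ x ∈ X, x ≠ xs → 0 < W x
  deriv_neg : ∀ x ∈ X, x ≠ xs → ∃ d : ℝ, HasOrbitalDeriv φ W x d ∧ d < 0

/-- `V : ℝⁿ → ℝ ∪ {+∞}` is a maximal Lyapunov function for the fixed point `xs` with basin of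
attraction `B`. -/
structure IsMaximalLyapunov {n : ℕ} (φ : ℝ → (Fin n → ℝ) → (Fin n → ℝ)) (xs : Fin n → ℝ)
    (B : Set (Fin n → ℝ)) (V : (Fin n → ℝ) → EReal) : Prop where
  ne_bot : ∀ x, V x ≠ ⊥
  zero : V xs = 0
  pos : ∀ x ∈ B, x ≠ xs → 0 < V x
  lt_top_iff : ∀ x, V x < ⊤ ↔ x ∈ B
  tendsto_frontier : ∀ y ∈ frontier B, Tendsto V (𝓝 y) (𝓝 ⊤)
  tendsto_infinity : Tendsto V (Bornology.cobounded (Fin n → ℝ)) (𝓝 ⊤)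
  hasDeriv : ∀ x ∈ B, ∃ d : ℝ, HasOrbitalDeriv φ (fun z => (V z).toReal) x d ∧ (x ≠ xs → d < 0)

end MonotoneKoopman

open MonotoneKoopman

/-! The vector `v₁` is real and nonzero, so `λ₁` is real, and it is negative. Near `x*` the function
`s₁` is positive in the direction `v₁`. The punctured cone above `x*` contains the segment between
any two of its points, and `s₁` has no zero on it, so `s₁ > 0` there near `x*`. Monotonicity keeps
orbits in the cone and the eigenfunction relation preserves signs along orbits, so `s₁ > 0` on the
whole punctured cone in the basin. The orbital derivative is `λ₁ s₁ < 0`.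

A maximal Lyapunov function needs differentiability only along orbits, so it may be chosen orbit by
orbit. Orbits that meet the cone get `s₁ + (entry time)²`, which equals `s₁` in the cone; the square
makes the term differentiable at the moment of entry. The other orbits get the exponential of the
hitting time of a compact sublevel set `{Q ≤ r}` of a local quadratic Lyapunov function. A bound on
either value bounds the time needed to reach `{Q ≤ r}` (`candidate_proper`), and flowing that set
backwards gives a compact subset of the basin. Hence the blow-up at the boundary and at infinity. -/

section Flow

/-! ### Uniqueness and local existence for autonomous equations -/

variable {E : Type*} [NormedAddCommGroup E] [NormedSpace ℝ E]

theorem eventuallyEq_of_hasDerivAt {f : E → E} {γ₁ γ₂ : ℝ → E} {t : ℝ}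
    (hf : ContDiffAt ℝ 1 f (γ₁ t))
    (h₁ : ∀ᶠ s in 𝓝 t, HasDerivAt γ₁ (f (γ₁ s)) s)
    (h₂ : ∀ᶠ s in 𝓝 t, HasDerivAt γ₂ (f (γ₂ s)) s) (heq : γ₁ t = γ₂ t) :
    γ₁ =ᶠ[𝓝 t] γ₂ := by
  obtain ⟨K, s, hs, hl⟩ := hf.exists_lipschitzOnWith
  refine ODE_solution_unique_of_eventually (v := fun _ => f) (s := fun _ => s) (K := K)
    (Eventually.of_forall fun _ => hl) ?_ ?_ heq
  · exact h₁.and (h₁.self_of_nhds.continuousAt.eventually hs)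
  · exact h₂.and (h₂.self_of_nhds.continuousAt.eventually (heq ▸ hs))

/-- The times near which the curves agree form an open set. It is relatively closed in `I`, because
agreement at a limit time follows from continuity and spreads by local uniqueness. -/
theorem eqOn_of_hasDerivAt {f : E → E} {D : Set E} (hf : ∀ x ∈ D, ContDiffAt ℝ 1 f x)
    {I : Set ℝ} (hI : IsOpen I) (hIc : IsPreconnected I) {γ₁ γ₂ : ℝ → E}
    (h₁ : ∀ t ∈ I, HasDerivAt γ₁ (f (γ₁ t)) t) (h₂ : ∀ t ∈ I, HasDerivAt γ₂ (f (γ₂ t)) t)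
    (hD : ∀ t ∈ I, γ₁ t ∈ D) {t₀ : ℝ} (ht₀ : t₀ ∈ I) (heq : γ₁ t₀ = γ₂ t₀) :
    EqOn γ₁ γ₂ I := by
  have key : ∀ t ∈ I, γ₁ t = γ₂ t → γ₁ =ᶠ[𝓝 t] γ₂ := fun t ht h =>
    eventuallyEq_of_hasDerivAt (hf _ (hD t ht)) (eventually_of_mem (hI.mem_nhds ht) h₁)
      (eventually_of_mem (hI.mem_nhds ht) h₂) h
  have hsub : I ⊆ {t | γ₁ =ᶠ[𝓝 t] γ₂} := by
    refine hIc.subset_of_closure_inter_subset isOpen_setOfPred_eventually_nhds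
      ⟨t₀, ht₀, key t₀ ht₀ heq⟩ ?_
    rintro t ⟨htc, ht⟩
    refine key t ht ?_
    have hfr : ∃ᶠ s in 𝓝 t, γ₁ s = γ₂ s :=
      (mem_closure_iff_frequently.1 htc).mono fun s hs => hs.self_of_nhds
    by_contra hne
    have hne' := ((h₁ t ht).continuousAt.prodMk (h₂ t ht).continuousAt).eventually
      ((isOpen_ne_fun continuous_fst continuous_snd).mem_nhds hne)
    exact hfr hne'
  exact fun t ht => (hsub ht).self_of_nhds

variable [CompleteSpace E]

theorem exists_local_flow_continuousOn {f : E → E} {U : Set E} {x₀ : E}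
    (hf : ContDiffAt ℝ 1 f x₀) (hU : U ∈ 𝓝 x₀) :
    ∃ α : E × ℝ → E, ∃ r > (0 : ℝ), ∃ ε > (0 : ℝ),
      ContinuousOn α (Metric.ball x₀ r ×ˢ Ioo (-ε) ε) ∧
      ∀ x ∈ Metric.ball x₀ r, α (x, 0) = x ∧ ∀ t ∈ Ioo (-ε) ε,
        α (x, t) ∈ U ∧ HasDerivAt (fun s => α (x, s)) (f (α (x, t))) t := by
  obtain ⟨ε, hε, a, r, L, K, hr, hpl⟩ := IsPicardLindelof.of_contDiffAt_one hf
  obtain ⟨α, hα, hc⟩ :=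
    (hpl 0).exists_forall_mem_closedBall_eq_hasDerivWithinAt_continuousOn
  have hr' : (0 : ℝ) < r := hr
  have hnhds : Metric.closedBall x₀ r ×ˢ Icc (0 - ε) (0 + ε) ∈ 𝓝 (x₀, (0 : ℝ)) :=
    prod_mem_nhds (Metric.closedBall_mem_nhds _ hr')
      (Icc_mem_nhds (by linarith) (by linarith))
  have hc0 : ContinuousAt α (x₀, 0) := hc.continuousAt hnhds
  have h0 : α (x₀, 0) = x₀ := (hα x₀ (Metric.mem_closedBall_self hr'.le)).1
  have hU' : ∀ᶠ p in 𝓝 (x₀, (0 : ℝ)), α p ∈ U := hc0.eventually (h0.symm ▸ hU)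
  obtain ⟨δ, hδ, hball⟩ := Metric.eventually_nhds_iff_ball.1 hU'
  refine ⟨α, min r δ, lt_min hr' hδ, min ε δ, lt_min hε hδ, hc.mono ?_, ?_⟩
  · rintro ⟨x, t⟩ ⟨hx, ht⟩
    have h1 := min_le_left ε δ
    exact ⟨Metric.ball_subset_closedBall (Metric.ball_subset_ball (min_le_left _ _) hx),
      by linarith [ht.1], by linarith [ht.2]⟩
  · intro x hx
    have hxr := Metric.ball_subset_closedBall (Metric.ball_subset_ball (min_le_left _ _) hx)
    refine ⟨(hα x hxr).1, fun t ht => ?_⟩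
    have h1 := min_le_left ε δ
    have h2 := min_le_right ε δ
    refine ⟨hball _ ?_, ((hα x hxr).2 t ⟨by linarith [ht.1], by linarith [ht.2]⟩).hasDerivAt
      (Icc_mem_nhds (by linarith [ht.1]) (by linarith [ht.2]))⟩
    rw [← ball_prod_same]
    refine ⟨Metric.ball_subset_ball (min_le_right _ _) hx, ?_⟩
    rw [Real.ball_eq_Ioo]
    exact ⟨by linarith [ht.1], by linarith [ht.2]⟩

end Flow

/-! ### Group law and continuous dependence for the flow -/

namespace MonotoneKoopman

variable {n : ℕ} {f : (Fin n → ℝ) → (Fin n → ℝ)} {D : Set (Fin n → ℝ)}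
  {φ : ℝ → (Fin n → ℝ) → (Fin n → ℝ)}

namespace IsFlowOn

theorem continuous_orbit (hφ : IsFlowOn f D φ) {x : Fin n → ℝ} (hx : x ∈ D) :
    Continuous fun t => φ t x :=
  continuous_iff_continuousAt.2 fun t => (hφ.hasDerivAt x hx t).continuousAt

theorem add (hφ : IsFlowOn f D φ) (hf : ∀ x ∈ D, ContDiffAt ℝ 1 f x) {x : Fin n → ℝ}
    (hx : x ∈ D) (s t : ℝ) : φ s (φ t x) = φ (s + t) x := by
  have h := eqOn_of_hasDerivAt hf isOpen_univ isPreconnected_univ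
    (γ₁ := fun s => φ s (φ t x)) (γ₂ := fun s => φ (s + t) x) (t₀ := 0)
    (fun s _ => hφ.hasDerivAt _ (hφ.mem x hx t) s)
    (fun s _ => (hφ.hasDerivAt x hx (s + t)).comp_add_const s t)
    (fun s _ => hφ.mem _ (hφ.mem x hx t) s) (mem_univ _)
    (by simp [hφ.init _ (hφ.mem x hx t)])
  exact h (mem_univ s)

theorem neg_cancel (hφ : IsFlowOn f D φ) (hf : ∀ x ∈ D, ContDiffAt ℝ 1 f x) {x : Fin n → ℝ}
    (hx : x ∈ D) (t : ℝ) : φ (-t) (φ t x) = x := by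
  rw [hφ.add hf hx, neg_add_cancel, hφ.init x hx]

theorem fixed (hφ : IsFlowOn f D φ) (hf : ∀ x ∈ D, ContDiffAt ℝ 1 f x) {x : Fin n → ℝ}
    (hx : x ∈ D) (h0 : f x = 0) (t : ℝ) : φ t x = x := by
  have h := eqOn_of_hasDerivAt hf isOpen_univ isPreconnected_univ
    (γ₁ := fun s => φ s x) (γ₂ := fun _ => x) (t₀ := 0)
    (fun s _ => hφ.hasDerivAt _ hx s)
    (fun s _ => by simpa [h0] using hasDerivAt_const s x)
    (fun s _ => hφ.mem _ hx s) (mem_univ _) (hφ.init x hx)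
  exact h (mem_univ t)

theorem continuousAt_of_small (hφ : IsFlowOn f D φ) (hD : IsOpen D)
    (hf : ∀ x ∈ D, ContDiffAt ℝ 1 f x) {x₀ : Fin n → ℝ} (hx₀ : x₀ ∈ D) :
    ∃ r > (0 : ℝ), ∃ ε > (0 : ℝ), ∀ x ∈ Metric.ball x₀ r, ∀ t ∈ Ioo (-ε) ε,
      ContinuousAt (φ t) x := by
  obtain ⟨α, r, hr, ε, hε, hc, hα⟩ :=
    exists_local_flow_continuousOn (hf x₀ hx₀) (hD.mem_nhds hx₀)
  have h0 : (0 : ℝ) ∈ Ioo (-ε) ε := ⟨by linarith, hε⟩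
  have heq : ∀ x ∈ Metric.ball x₀ r, ∀ t ∈ Ioo (-ε) ε, α (x, t) = φ t x := by
    intro x hx
    have hxD : x ∈ D := by simpa [(hα x hx).1] using ((hα x hx).2 0 h0).1
    exact eqOn_of_hasDerivAt hf isOpen_Ioo isPreconnected_Ioo
      (fun t ht => ((hα x hx).2 t ht).2) (fun t _ => hφ.hasDerivAt x hxD t)
      (fun t ht => ((hα x hx).2 t ht).1) h0 (by rw [(hα x hx).1, hφ.init x hxD])
  refine ⟨r, hr, ε, hε, fun x hx t ht => ?_⟩
  have hn : Metric.ball x₀ r ×ˢ Ioo (-ε) ε ∈ 𝓝 (x, t) :=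
    (Metric.isOpen_ball.prod isOpen_Ioo).mem_nhds ⟨hx, ht⟩
  have h1 : ContinuousAt (fun y => α (y, t)) x :=
    ContinuousAt.comp (f := fun y => (y, t)) (hc.continuousAt hn) (by fun_prop)
  refine h1.congr (eventually_of_mem (Metric.isOpen_ball.mem_nhds hx) fun y hy => heq y hy t ht)

/-- Continuous dependence on the initial value. -/
theorem continuousAt (hφ : IsFlowOn f D φ) (hD : IsOpen D)
    (hf : ∀ x ∈ D, ContDiffAt ℝ 1 f x) {x : Fin n → ℝ} (hx : x ∈ D) (t : ℝ) :
    ContinuousAt (φ t) x := by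
  have step : ∀ s t, ContinuousAt (φ s) x → ContinuousAt (φ (t - s)) (φ s x) →
      ContinuousAt (φ t) x := by
    intro s t h1 h2
    refine (ContinuousAt.comp h2 h1).congr (eventually_of_mem (hD.mem_nhds hx) fun y hy => ?_)
    simp [hφ.add hf hy]
  -- The time step `ε` is uniform over a ball, so one can step from `t₀` to `t` and also back from
  -- `t` to `t₀`. Both directions are needed for the set of good times to be clopen.
  have hloc : ∀ t₀, ∀ᶠ t in 𝓝 t₀, ContinuousAt (φ t) x ↔ ContinuousAt (φ t₀) x := by
    intro t₀
    obtain ⟨r, hr, ε, hε, h⟩ := hφ.continuousAt_of_small hD hf (hφ.mem x hx t₀)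
    have h1 : ∀ᶠ t in 𝓝 t₀, φ t x ∈ Metric.ball (φ t₀ x) r :=
      (hφ.continuous_orbit hx).continuousAt.eventually (Metric.ball_mem_nhds _ hr)
    filter_upwards [h1, Ioo_mem_nhds (sub_lt_self t₀ hε) (lt_add_of_pos_right t₀ hε)]
      with t ht ht'
    exact ⟨fun hc => step t t₀ hc (h _ ht _ ⟨by linarith [ht'.2], by linarith [ht'.1]⟩),
      fun hc => step t₀ t hc (h _ (Metric.mem_ball_self hr) _
        ⟨by linarith [ht'.1], by linarith [ht'.2]⟩)⟩
  have hclopen : IsClopen {t | ContinuousAt (φ t) x} := by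
    refine ⟨⟨isOpen_iff_mem_nhds.2 fun t ht => ?_⟩, isOpen_iff_mem_nhds.2 fun t ht => ?_⟩
    · filter_upwards [hloc t] with s hs hs'
      exact ht (hs.1 hs')
    · filter_upwards [hloc t] with s hs
      exact hs.2 ht
  have h0 : ContinuousAt (φ 0) x :=
    continuousAt_id.congr (eventually_of_mem (hD.mem_nhds hx) fun y hy => (hφ.init y hy).symm)
  have hmem : t ∈ {t | ContinuousAt (φ t) x} := by
    rw [hclopen.eq_univ ⟨0, h0⟩]
    exact mem_univ t
  exact hmem

end IsFlowOn

end MonotoneKoopman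

/-! ### A quadratic Lyapunov function near the fixed point -/

namespace MonotoneKoopman

variable {n : ℕ} {f : (Fin n → ℝ) → (Fin n → ℝ)} {D : Set (Fin n → ℝ)}

theorem jacobian_mulVec_ofReal (f : (Fin n → ℝ) → (Fin n → ℝ)) (x y : Fin n → ℝ) :
    (jacobian f x).mulVec (fun i => (y i : ℂ)) = fun i => ((fderiv ℝ f x y i : ℝ) : ℂ) := by
  ext i
  have h := (fderiv ℝ f x).toLinearMap.pi_apply_eq_sum_univ y
  have h' : fderiv ℝ f x y i = ∑ j, fderiv ℝ f x (Pi.single j 1) i * y j := by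
    have := congrFun h i
    simp only [ContinuousLinearMap.coe_coe, Finset.sum_apply, Pi.smul_apply, smul_eq_mul] at this
    rw [this]
    refine Finset.sum_congr rfl fun j _ => ?_
    rw [mul_comm]
    have he : (fun k => if j = k then (1 : ℝ) else 0) = Pi.single j 1 := by
      ext k
      simp [Pi.single_apply, eq_comm]
    rw [he]
  rw [h']
  simp [Matrix.mulVec, dotProduct, jacobian]

/-- Coordinates in an eigenbasis turn a diagonalizable stable Jacobian into a dissipative one. -/
theorem exists_dissipative_coordinates {xs : Fin n → ℝ} (hs : IsStableHyperbolic f xs)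
    (hd : IsDiagonalizable (jacobian f xs)) :
    ∃ (L : (Fin n → ℝ) →L[ℝ] EuclideanSpace ℂ (Fin n)) (K α : ℝ), 0 ≤ K ∧ 0 < α ∧
      (∀ y, ‖y‖ ≤ K * ‖L y‖) ∧
      ∀ y, inner ℝ (L y) (L (fderiv ℝ f xs y)) ≤ -α * ‖L y‖ ^ 2 := by
  obtain ⟨b, hb⟩ := hd
  choose μ hμ using hb
  have hspec : ∀ i, (μ i).re < 0 := by
    intro i
    refine hs.2 _ ?_
    rw [← Matrix.spectrum_toLin']
    refine Module.End.HasEigenvalue.mem_spectrum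
      (Module.End.hasEigenvalue_of_hasEigenvector (x := b i) ?_)
    exact ⟨Module.End.mem_eigenspace_iff.2 (by simpa using hμ i), b.ne_zero i⟩
  obtain ⟨α, hα0, hα⟩ : ∃ α : ℝ, 0 < α ∧ ∀ i, (μ i).re ≤ -α := by
    -- A filter argument instead of a minimum over the eigenvalues also covers `n = 0`.
    have h1 : ∀ᶠ α in 𝓝[>] (0 : ℝ), ∀ i, (μ i).re ≤ -α := by
      refine eventually_all.2 fun i => nhdsWithin_le_nhds ?_
      filter_upwards [gt_mem_nhds (show (0 : ℝ) < -(μ i).re by linarith [hspec i])] with α hα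
      linarith
    obtain ⟨α, h, h'⟩ := (h1.and self_mem_nhdsWithin).exists
    exact ⟨α, h', h⟩
  have hrepr : ∀ v i, b.repr ((jacobian f xs).mulVec v) i = μ i * b.repr v i := by
    intro v i
    have h : (b.coord i) ∘ₗ (Matrix.toLin' (jacobian f xs)) = μ i • b.coord i := by
      refine b.ext fun j => ?_
      simp only [LinearMap.comp_apply, Matrix.toLin'_apply, hμ, LinearMap.smul_apply, map_smul,
        Module.Basis.coord_apply, Module.Basis.repr_self, smul_eq_mul]
      by_cases hij : j = i
      · simp [hij]
      · simp [hij]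
    simpa using LinearMap.congr_fun h v
  let L₀ : (Fin n → ℝ) →ₗ[ℝ] EuclideanSpace ℂ (Fin n) :=
    { toFun := fun y => WithLp.toLp 2 (b.equivFun (fun i => (y i : ℂ)))
      map_add' := fun x y => by
        ext i
        have : (fun i => ((x + y) i : ℂ)) = (fun i => (x i : ℂ)) + fun i => (y i : ℂ) := by
          ext; simp
        change b.repr _ i = b.repr _ i + b.repr _ i
        rw [this, map_add]
        rfl
      map_smul' := fun c y => by
        ext i
        have : (fun i => ((c • y) i : ℂ)) = (c : ℂ) • fun i => (y i : ℂ) := by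
          ext; simp
        change b.repr _ i = (c : ℂ) * b.repr _ i
        rw [this, map_smul]
        rfl }
  have hL₀ : ∀ y i, L₀ y i = b.repr (fun i => (y i : ℂ)) i := fun y i => rfl
  have hinj : Function.Injective L₀ := by
    intro x y hxy
    have h : b.repr (fun i => (x i : ℂ)) = b.repr (fun i => (y i : ℂ)) := by
      ext i
      rw [← hL₀, hxy, hL₀]
    ext i
    exact_mod_cast congrFun (b.repr.injective h) i
  obtain ⟨K, -, hK⟩ := L₀.exists_antilipschitzWith (LinearMap.ker_eq_bot.2 hinj)
  refine ⟨L₀.toContinuousLinearMap, K, α, K.2, hα0, fun y => ?_, fun y => ?_⟩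
  · simpa using hK.le_mul_norm_sub y 0
  · have hLJ : ∀ i, L₀ (fderiv ℝ f xs y) i = μ i * L₀ y i := by
      intro i
      rw [hL₀, hL₀, ← hrepr, jacobian_mulVec_ofReal]
    -- The real inner product is the real part of the Hermitian one, so only `(μ i).re` survives in
    -- the estimate.
    have hin : ∀ u w : EuclideanSpace ℂ (Fin n), inner ℝ u w = ∑ i, (w i * star (u i)).re := by
      intro u w
      rw [PiLp.inner_apply]
      simp [Complex.inner, mul_comm]
    simp only [LinearMap.coe_toContinuousLinearMap']
    rw [hin, EuclideanSpace.norm_sq_eq, Finset.mul_sum]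
    refine Finset.sum_le_sum fun i _ => ?_
    rw [hLJ, mul_assoc, Complex.star_def, Complex.mul_conj, Complex.re_mul_ofReal,
      Complex.normSq_eq_norm_sq]
    exact mul_le_mul_of_nonneg_right (hα i) (sq_nonneg _)

/-- `Q` is a strict local Lyapunov function at `xs` whose sublevel set at height `r` is compact and
forward invariant; along solutions in it `Q` decays at rate `α`. -/
structure IsLocalLyapunov (f : (Fin n → ℝ) → (Fin n → ℝ)) (D : Set (Fin n → ℝ))
    (xs : Fin n → ℝ) (Q Q' : (Fin n → ℝ) → ℝ) (r α : ℝ) : Prop where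
  r_pos : 0 < r
  α_pos : 0 < α
  continuous : Continuous Q
  zero : Q xs = 0
  pos : ∀ x, x ≠ xs → 0 < Q x
  tendsto_of_tendsto : ∀ u : ℝ → Fin n → ℝ, Tendsto (fun t => Q (u t)) atTop (𝓝 0) →
    Tendsto u atTop (𝓝 xs)
  compact : IsCompact {x | Q x ≤ r}
  subset : {x | Q x ≤ r} ⊆ D
  hasDerivAt : ∀ (γ : ℝ → Fin n → ℝ) (t : ℝ), HasDerivAt γ (f (γ t)) t →
    HasDerivAt (fun s => Q (γ s)) (Q' (γ t)) t
  decay : ∀ x, Q x ≤ r → Q' x ≤ -α * Q x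

/-- For `Q x = ‖L (x - xs)‖ ^ 2` the linear part gives decay rate `2α`; half of it absorbs the
remainder of the linearization. -/
theorem exists_isLocalLyapunov (hD : IsOpen D) {xs : Fin n → ℝ} (hxs : xs ∈ D)
    (hf : DifferentiableAt ℝ f xs) (hs : IsStableHyperbolic f xs)
    (hd : IsDiagonalizable (jacobian f xs)) :
    ∃ Q Q' r α, IsLocalLyapunov f D xs Q Q' r α := by
  obtain ⟨L, K, α, hK0, hα0, hK, hα⟩ := exists_dissipative_coordinates hs hd
  set c : ℝ := α / (2 * (‖L‖ * K + 1)) with hc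
  have hc0 : 0 < c := by positivity
  have hcb : ‖L‖ * c * K ≤ α / 2 := by
    rw [hc]
    have h1 : 0 ≤ ‖L‖ * K := by positivity
    have : ‖L‖ * (α / (2 * (‖L‖ * K + 1))) * K = α / 2 * (‖L‖ * K / (‖L‖ * K + 1)) := by
      field_simp
    rw [this]
    refine mul_le_of_le_one_right (by positivity) ?_
    rw [div_le_one (by positivity)]
    linarith
  have hlin := hf.hasFDerivAt.isLittleO.def hc0
  obtain ⟨δ, hδ, hball⟩ := Metric.eventually_nhds_iff_ball.1 (hlin.and (hD.mem_nhds hxs))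
  -- With this radius `‖y‖ ≤ K * ‖L y‖` puts the sublevel set in the closed ball of radius `δ / 2`,
  -- where the remainder bound and membership in `D` hold.
  set ρ : ℝ := δ / (2 * (K + 1)) with hρ
  have hρ0 : 0 < ρ := by positivity
  have hsmall : ∀ x, ‖L (x - xs)‖ ^ 2 ≤ ρ ^ 2 → ‖x - xs‖ ≤ δ / 2 := by
    intro x hx
    have h1 : ‖L (x - xs)‖ ≤ ρ := le_of_sq_le_sq hx hρ0.le
    have h2 : K * ρ ≤ δ / 2 := by
      have : K * ρ = δ / 2 * (K / (K + 1)) := by rw [hρ]; field_simp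
      rw [this]
      refine mul_le_of_le_one_right (by positivity) ?_
      rw [div_le_one (by positivity)]
      linarith
    exact (hK _).trans ((mul_le_mul_of_nonneg_left h1 hK0).trans h2)
  have hmem : ∀ x, ‖L (x - xs)‖ ^ 2 ≤ ρ ^ 2 → x ∈ Metric.ball xs δ := by
    intro x hx
    rw [mem_ball_iff_norm]
    linarith [hsmall x hx]
  have hcont : Continuous fun x => ‖L (x - xs)‖ ^ 2 := by fun_prop
  refine ⟨fun x => ‖L (x - xs)‖ ^ 2, fun x => 2 * inner ℝ (L (x - xs)) (L (f x)), ρ ^ 2, α,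
    by positivity, hα0, hcont, by simp, ?_, ?_, ?_, ?_, ?_, ?_⟩
  · intro x hx
    have h1 : 0 < ‖x - xs‖ := norm_pos_iff.2 (sub_ne_zero.2 hx)
    have h2 : ‖L (x - xs)‖ ≠ 0 := by
      intro h
      have := hK (x - xs)
      rw [h, mul_zero] at this
      linarith
    positivity
  · intro u hu
    have h1 : Tendsto (fun t => ‖L (u t - xs)‖) atTop (𝓝 0) := by
      simpa using hu.sqrt
    rw [tendsto_iff_norm_sub_tendsto_zero]
    exact squeeze_zero (fun t => norm_nonneg _) (fun t => hK _) (by simpa using h1.const_mul K)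
  · refine (isCompact_closedBall xs (δ / 2)).of_isClosed_subset
      (isClosed_le hcont continuous_const) fun x hx => ?_
    rw [mem_closedBall_iff_norm]
    exact hsmall x hx
  · exact fun x hx => (hball x (hmem x hx)).2
  · intro γ t h
    have h1 : HasDerivAt (fun s => L (γ s - xs)) (L (f (γ t))) t :=
      L.hasFDerivAt.comp_hasDerivAt t (h.sub_const xs)
    exact h1.norm_sq
  · intro x hx
    have h1 := (hball x (hmem x hx)).1
    rw [hs.1, sub_zero] at h1
    set y := x - xs with hy
    set R := f x - fderiv ℝ f xs y with hR
    have h2 : f x = fderiv ℝ f xs y + R := by simp [hR]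
    rw [h2, map_add, inner_add_right]
    have h3 : ‖L R‖ ≤ α / 2 * ‖L y‖ := calc
      ‖L R‖ ≤ ‖L‖ * ‖R‖ := L.le_opNorm R
      _ ≤ ‖L‖ * (c * (K * ‖L y‖)) := by
        gcongr
        exact h1.trans (by gcongr; exact hK y)
      _ = ‖L‖ * c * K * ‖L y‖ := by ring
      _ ≤ α / 2 * ‖L y‖ := by gcongr
    have h4 : inner ℝ (L y) (L R) ≤ ‖L y‖ * (α / 2 * ‖L y‖) :=
      (real_inner_le_norm _ _).trans (by gcongr)
    have h5 := hα y
    nlinarith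

end MonotoneKoopman

/-! ### The basin and the hitting time of `{Q ≤ r}` -/

namespace MonotoneKoopman

variable {n : ℕ} {f : (Fin n → ℝ) → (Fin n → ℝ)} {D : Set (Fin n → ℝ)}
  {φ : ℝ → (Fin n → ℝ) → (Fin n → ℝ)} {xs x : Fin n → ℝ}

theorem flow_mem_basin (hφ : IsFlowOn f D φ) (hf : ∀ x ∈ D, ContDiffAt ℝ 1 f x)
    (hx : x ∈ basin D φ xs) (t : ℝ) : φ t x ∈ basin D φ xs := by
  refine ⟨hφ.mem x hx.1 t, ?_⟩
  simp only [hφ.add hf hx.1]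
  exact hx.2.comp (tendsto_atTop_add_const_right _ t tendsto_id)

theorem flow_ne (hφ : IsFlowOn f D φ) (hf : ∀ x ∈ D, ContDiffAt ℝ 1 f x) (hxs : xs ∈ D)
    (h0 : f xs = 0) (hx : x ∈ D) (hne : x ≠ xs) (t : ℝ) : φ t x ≠ xs := by
  intro h
  have := hφ.neg_cancel hf hx t
  rw [h, hφ.fixed hf hxs h0] at this
  exact hne this.symm

theorem self_mem_basin (hφ : IsFlowOn f D φ) (hf : ∀ x ∈ D, ContDiffAt ℝ 1 f x) (hxs : xs ∈ D)
    (h0 : f xs = 0) : xs ∈ basin D φ xs := by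
  refine ⟨hxs, ?_⟩
  simp only [hφ.fixed hf hxs h0]
  exact tendsto_const_nhds

/-- The time at which the orbit of `x` enters the sublevel set `{Q ≤ r}`. -/
noncomputable def hittingTime (φ : ℝ → (Fin n → ℝ) → (Fin n → ℝ)) (Q : (Fin n → ℝ) → ℝ) (r : ℝ)
    (x : Fin n → ℝ) : ℝ :=
  sInf {t | Q (φ t x) ≤ r}

namespace IsLocalLyapunov

variable {Q Q' : (Fin n → ℝ) → ℝ} {r α : ℝ}

theorem nonneg (hQ : IsLocalLyapunov f D xs Q Q' r α) (x : Fin n → ℝ) : 0 ≤ Q x := by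
  rcases eq_or_ne x xs with rfl | h
  · exact hQ.zero.ge
  · exact (hQ.pos x h).le

theorem hasDerivAt_orbit (hQ : IsLocalLyapunov f D xs Q Q' r α) (hφ : IsFlowOn f D φ)
    (hx : x ∈ D) (t : ℝ) : HasDerivAt (fun s => Q (φ s x)) (Q' (φ t x)) t :=
  hQ.hasDerivAt _ t (hφ.hasDerivAt x hx t)

theorem continuous_orbit (hQ : IsLocalLyapunov f D xs Q Q' r α) (hφ : IsFlowOn f D φ)
    (hx : x ∈ D) : Continuous fun s => Q (φ s x) :=
  hQ.continuous.comp (hφ.continuous_orbit hx)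

/-- Barrier argument: on the level `Q = r` the derivative is at most `-α * r < 0`. -/
theorem forward_le (hQ : IsLocalLyapunov f D xs Q Q' r α) (hφ : IsFlowOn f D φ) (hx : x ∈ D)
    {s t : ℝ} (hst : s ≤ t) (hs : Q (φ s x) ≤ r) : Q (φ t x) ≤ r := by
  refine image_le_of_deriv_right_lt_deriv_boundary (a := s) (b := t)
    (hQ.continuous_orbit hφ hx).continuousOn
    (fun u _ => (hQ.hasDerivAt_orbit hφ hx u).hasDerivWithinAt) (B := fun _ => r) hs
    (fun u => hasDerivAt_const u r) (fun u _ hu => ?_) (right_mem_Icc.2 hst)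
  have h1 := hQ.decay (φ u x) hu.le
  have h2 : 0 < α * Q (φ u x) := by
    rw [hu]
    exact mul_pos hQ.α_pos hQ.r_pos
  linarith

theorem exp_decay (hQ : IsLocalLyapunov f D xs Q Q' r α) (hφ : IsFlowOn f D φ) (hx : x ∈ D)
    {s t : ℝ} (hst : s ≤ t) (hs : Q (φ s x) ≤ r) :
    Q (φ t x) ≤ Q (φ s x) * Real.exp (-α * (t - s)) := by
  have hd : ∀ u, HasDerivAt (fun u => Q (φ u x) * Real.exp (α * u))
      (Q' (φ u x) * Real.exp (α * u) + Q (φ u x) * (Real.exp (α * u) * α)) u := fun u =>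
    (hQ.hasDerivAt_orbit hφ hx u).mul (by simpa using ((hasDerivAt_id u).const_mul α).exp)
  have hanti : AntitoneOn (fun u => Q (φ u x) * Real.exp (α * u)) (Ici s) := by
    refine antitoneOn_of_deriv_nonpos (convex_Ici s)
      (fun u _ => (hd u).continuousAt.continuousWithinAt)
      (fun u _ => (hd u).differentiableAt.differentiableWithinAt) fun u hu => ?_
    rw [interior_Ici] at hu
    rw [(hd u).deriv]
    have h1 := hQ.decay _ (hQ.forward_le hφ hx (le_of_lt hu) hs)
    have h2 := Real.exp_pos (α * u)
    have h3 := mul_le_mul_of_nonneg_right h1 h2.le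
    linarith
  have h := hanti self_mem_Ici hst hst
  have he : Real.exp (-α * (t - s)) = Real.exp (α * s) / Real.exp (α * t) := by
    rw [← Real.exp_sub]
    ring_nf
  rw [he, mul_div_assoc', le_div_iff₀ (Real.exp_pos _)]
  exact h

theorem sublevel_subset_basin (hQ : IsLocalLyapunov f D xs Q Q' r α) (hφ : IsFlowOn f D φ) :
    {x | Q x ≤ r} ⊆ basin D φ xs := by
  intro x hx
  have hxD := hQ.subset hx
  refine ⟨hxD, hQ.tendsto_of_tendsto _ ?_⟩
  have h0 : Q (φ 0 x) ≤ r := by rwa [hφ.init x hxD]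
  have hexp : Tendsto (fun t : ℝ => Q (φ 0 x) * Real.exp (-α * (t - 0))) atTop (𝓝 0) := by
    have h1 : Tendsto (fun t : ℝ => α * t) atTop atTop := tendsto_id.const_mul_atTop hQ.α_pos
    have := (Real.tendsto_exp_neg_atTop_nhds_zero.comp h1).const_mul (Q (φ 0 x))
    simpa [Function.comp_def] using this
  refine tendsto_of_tendsto_of_tendsto_of_le_of_le' tendsto_const_nhds hexp
    (Eventually.of_forall fun t => hQ.nonneg _) ?_
  filter_upwards [eventually_ge_atTop 0] with t ht using hQ.exp_decay hφ hxD ht h0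

theorem tendsto_orbit (hQ : IsLocalLyapunov f D xs Q Q' r α) (hx : x ∈ basin D φ xs) :
    Tendsto (fun t => Q (φ t x)) atTop (𝓝 0) := by
  have := (hQ.continuous.tendsto xs).comp hx.2
  rwa [hQ.zero] at this

/-- Being in `{Q < r}` at a fixed time is an open condition by continuous dependence, and the basin
is invariant under the backward flow. -/
theorem isOpen_basin (hQ : IsLocalLyapunov f D xs Q Q' r α) (hφ : IsFlowOn f D φ)
    (hD : IsOpen D) (hf : ∀ x ∈ D, ContDiffAt ℝ 1 f x) : IsOpen (basin D φ xs) := by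
  refine isOpen_iff_mem_nhds.2 fun x hx => ?_
  obtain ⟨t, ht⟩ := ((hQ.tendsto_orbit hx).eventually (gt_mem_nhds hQ.r_pos)).exists
  have hc : ContinuousAt (fun y => Q (φ t y)) x :=
    hQ.continuous.continuousAt.comp (hφ.continuousAt hD hf hx.1 t)
  filter_upwards [hD.mem_nhds hx.1, hc.eventually (gt_mem_nhds ht)] with y hy hy'
  have := flow_mem_basin hφ hf (hQ.sublevel_subset_basin hφ hy'.le) (-t)
  rwa [hφ.neg_cancel hf hy] at this

/-- Every nontrivial orbit in the basin meets the level set `{Q = r}`. -/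
theorem exists_hitting (hQ : IsLocalLyapunov f D xs Q Q' r α) (hφ : IsFlowOn f D φ)
    (hf : ∀ x ∈ D, ContDiffAt ℝ 1 f x) (hxs : xs ∈ D) (h0 : f xs = 0)
    (hx : x ∈ basin D φ xs) (hne : x ≠ xs) : ∃ t, Q (φ t x) = r := by
  obtain ⟨t₁, ht₁⟩ := ((hQ.tendsto_orbit hx).eventually (gt_mem_nhds hQ.r_pos)).exists
  have hpos : 0 < Q (φ t₁ x) := hQ.pos _ (flow_ne hφ hf hxs h0 hx.1 hne t₁)
  -- If `Q ≤ r` at all times, decay started at `t₁ - s` gives `Q (φ t₁ x) ≤ r * exp (-(α * s))` for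
  -- every `s ≥ 0`, which forces `Q (φ t₁ x)` to vanish.
  obtain ⟨t₀, ht₀⟩ : ∃ t₀, r < Q (φ t₀ x) := by
    by_contra! hle
    have h1 : Tendsto (fun s : ℝ => α * s) atTop atTop := tendsto_id.const_mul_atTop hQ.α_pos
    have h2 : Tendsto (fun s : ℝ => r * Real.exp (-(α * s))) atTop (𝓝 0) := by
      simpa [Function.comp_def] using
        (Real.tendsto_exp_neg_atTop_nhds_zero.comp h1).const_mul r
    obtain ⟨s, hs, hs'⟩ :=
      ((h2.eventually (gt_mem_nhds hpos)).and (eventually_ge_atTop 0)).exists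
    have h3 := hQ.exp_decay hφ hx.1 (s := t₁ - s) (t := t₁) (by linarith) (hle _)
    have h4 : -α * (t₁ - (t₁ - s)) = -(α * s) := by ring
    rw [h4] at h3
    have h5 := mul_le_mul_of_nonneg_right (hle (t₁ - s)) (Real.exp_pos (-(α * s))).le
    linarith
  exact mem_range_of_exists_le_of_exists_ge (hQ.continuous_orbit hφ hx.1) ⟨t₁, ht₁.le⟩
    ⟨t₀, ht₀.le⟩

theorem hittingTime_eq (hQ : IsLocalLyapunov f D xs Q Q' r α) (hφ : IsFlowOn f D φ)
    (hx : x ∈ D) {t : ℝ} (ht : Q (φ t x) = r) : hittingTime φ Q r x = t := by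
  have hset : {t | Q (φ t x) ≤ r} = Ici t := by
    ext s
    refine ⟨fun hs => ?_, fun hs => hQ.forward_le hφ hx hs ht.le⟩
    by_contra hlt
    rw [mem_Ici, not_le] at hlt
    have h1 := hQ.exp_decay hφ hx hlt.le hs
    have h2 : Real.exp (-α * (t - s)) < 1 := by
      rw [Real.exp_lt_one_iff]
      nlinarith [hQ.α_pos]
    have h3 := mul_le_mul_of_nonneg_right (show Q (φ s x) ≤ r from hs)
      (Real.exp_pos (-α * (t - s))).le
    have := hQ.r_pos
    rw [ht] at h1
    nlinarith
  rw [hittingTime, hset, csInf_Ici]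

/-- The infimum runs over all real times, negative ones included, so there is no truncation and the
hitting time is affine along the entire orbit. -/
theorem hittingTime_flow (hQ : IsLocalLyapunov f D xs Q Q' r α) (hφ : IsFlowOn f D φ)
    (hf : ∀ x ∈ D, ContDiffAt ℝ 1 f x) (hxs : xs ∈ D) (h0 : f xs = 0)
    (hx : x ∈ basin D φ xs) (hne : x ≠ xs) (t : ℝ) :
    hittingTime φ Q r (φ t x) = hittingTime φ Q r x - t := by
  obtain ⟨τ, hτ⟩ := hQ.exists_hitting hφ hf hxs h0 hx hne
  rw [hQ.hittingTime_eq hφ hx.1 hτ]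
  refine hQ.hittingTime_eq hφ (hφ.mem x hx.1 t) ?_
  rwa [hφ.add hf hx.1, sub_add_cancel]

theorem flow_hittingTime (hQ : IsLocalLyapunov f D xs Q Q' r α) (hφ : IsFlowOn f D φ)
    (hf : ∀ x ∈ D, ContDiffAt ℝ 1 f x) (hxs : xs ∈ D) (h0 : f xs = 0)
    (hx : x ∈ basin D φ xs) (hne : x ≠ xs) : Q (φ (hittingTime φ Q r x) x) = r := by
  obtain ⟨τ, hτ⟩ := hQ.exists_hitting hφ hf hxs h0 hx hne
  rwa [hQ.hittingTime_eq hφ hx.1 hτ]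

/-- The set of points reaching `{Q ≤ r}` by time `T` is contained in a compact subset of the
basin. -/
theorem exists_compact (hQ : IsLocalLyapunov f D xs Q Q' r α) (hφ : IsFlowOn f D φ)
    (hD : IsOpen D) (hf : ∀ x ∈ D, ContDiffAt ℝ 1 f x) (T : ℝ) :
    ∃ C ⊆ basin D φ xs, IsCompact C ∧ ∀ x ∈ D, Q (φ T x) ≤ r → x ∈ C := by
  refine ⟨φ (-T) '' {x | Q x ≤ r}, ?_, hQ.compact.image_of_continuousOn fun x hx =>
    (hφ.continuousAt hD hf (hQ.subset hx) _).continuousWithinAt,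
    fun x hx h => ⟨φ T x, h, hφ.neg_cancel hf hx T⟩⟩
  rintro _ ⟨x, hx, rfl⟩
  exact flow_mem_basin hφ hf (hQ.sublevel_subset_basin hφ hx) _

end IsLocalLyapunov

/-! ### Extension of proper functions by `⊤` -/

/-- A function on the basin, extended by `⊤`. -/
noncomputable def extendTop (B : Set (Fin n → ℝ)) (W : (Fin n → ℝ) → ℝ) (x : Fin n → ℝ) : EReal :=
  open Classical in if x ∈ B then (W x : EReal) else ⊤

theorem extendTop_of_mem {B : Set (Fin n → ℝ)} (W : (Fin n → ℝ) → ℝ) (hx : x ∈ B) :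
    extendTop B W x = W x :=
  if_pos hx

theorem extendTop_of_notMem {B : Set (Fin n → ℝ)} (W : (Fin n → ℝ) → ℝ) (hx : x ∉ B) :
    extendTop B W x = ⊤ :=
  if_neg hx

/-- A strictly decreasing function with relatively compact sublevel sets in the basin extends to a
maximal Lyapunov function. -/
theorem isMaximalLyapunov_extendTop {B : Set (Fin n → ℝ)} {W : (Fin n → ℝ) → ℝ} (hB : IsOpen B)
    (hxs : xs ∈ B) (hflow : ∀ x ∈ B, ∀ t, φ t x ∈ B) (h0 : W xs = 0)
    (hpos : ∀ x ∈ B, x ≠ xs → 0 < W x)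
    (hproper : ∀ M : ℝ, ∃ C ⊆ B, IsCompact C ∧ ∀ x ∈ B, W x ≤ M → x ∈ C)
    (hderiv : ∀ x ∈ B, ∃ d, HasOrbitalDeriv φ W x d ∧ (x ≠ xs → d < 0)) :
    IsMaximalLyapunov φ xs B (extendTop B W) := by
  -- Both limits follow from this: `C` is closed and misses the frontier of the open set `B`, and
  -- `C` is bounded.
  have hlt : ∀ M : ℝ, ∃ C ⊆ B, IsCompact C ∧ ∀ x ∉ C, (M : EReal) < extendTop B W x := by
    intro M
    obtain ⟨C, hCB, hC, h⟩ := hproper M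
    refine ⟨C, hCB, hC, fun x hx => ?_⟩
    by_cases hxB : x ∈ B
    · rw [extendTop_of_mem W hxB, EReal.coe_lt_coe_iff]
      by_contra hle
      exact hx (h x hxB (not_lt.1 hle))
    · rw [extendTop_of_notMem W hxB]
      exact EReal.coe_lt_top M
  refine ⟨fun x => ?_, ?_, fun x hx hne => ?_, fun x => ?_, fun y hy => ?_, ?_, fun x hx => ?_⟩
  · by_cases hx : x ∈ B
    · simp [extendTop_of_mem W hx]
    · simp [extendTop_of_notMem W hx]
  · rw [extendTop_of_mem W hxs, h0, EReal.coe_zero]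
  · rw [extendTop_of_mem W hx]
    exact_mod_cast hpos x hx hne
  · by_cases hx : x ∈ B
    · simp [extendTop_of_mem W hx, hx, EReal.coe_lt_top]
    · simp [extendTop_of_notMem W hx, hx]
  · rw [EReal.tendsto_nhds_top_iff_real]
    intro M
    obtain ⟨C, hCB, hC, h⟩ := hlt M
    have hyB : y ∉ B := by
      rw [hB.frontier_eq] at hy
      exact hy.2
    filter_upwards [hC.isClosed.isOpen_compl.mem_nhds fun hyC => hyB (hCB hyC)] with x hx
      using h x hx
  · rw [EReal.tendsto_nhds_top_iff_real]
    intro M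
    obtain ⟨C, -, hC, h⟩ := hlt M
    filter_upwards [Bornology.isBounded_def.1 hC.isBounded] with x hx using h x hx
  · obtain ⟨d, hd, hd'⟩ := hderiv x hx
    refine ⟨d, ?_, hd'⟩
    have : (fun t => (extendTop B W (φ t x)).toReal) = fun t => W (φ t x) := by
      ext t
      rw [extendTop_of_mem W (hflow x hx t), EReal.toReal_coe]
    rw [HasOrbitalDeriv, this]
    exact hd

end MonotoneKoopman

/-! ### Signs and decay of the dominant eigenfunction -/

theorem hasDerivAt_max_zero_sq (u : ℝ) :
    HasDerivAt (fun u : ℝ => max u 0 ^ 2) (2 * max u 0) u := by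
  rcases lt_trichotomy u 0 with h | rfl | h
  · rw [max_eq_right h.le, mul_zero]
    refine (hasDerivAt_const u (0 : ℝ)).congr_of_eventuallyEq ?_
    filter_upwards [gt_mem_nhds h] with v hv
    simp [max_eq_right hv.le]
  · rw [hasDerivAt_iff_isLittleO]
    have h1 : (fun v : ℝ => v ^ 2) =o[𝓝 0] fun v => v := by
      simpa using Asymptotics.isLittleO_pow_id (𝕜 := ℝ) one_lt_two
    refine Asymptotics.IsBigO.trans_isLittleO (g := fun v : ℝ => v ^ 2) ?_ (by simpa using h1)
    refine Asymptotics.IsBigO.of_bound 1 (Eventually.of_forall fun v => ?_)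
    rcases le_total v 0 with hv | hv <;> simp [hv, sq_nonneg]
  · rw [max_eq_left h.le]
    refine (by simpa using hasDerivAt_pow 2 u : HasDerivAt (fun u : ℝ => u ^ 2) (2 * u) u)
      |>.congr_of_eventuallyEq ?_
    filter_upwards [lt_mem_nhds h] with v hv
    simp [max_eq_left hv.le]

namespace MonotoneKoopman

variable {n : ℕ} {f : (Fin n → ℝ) → (Fin n → ℝ)} {D : Set (Fin n → ℝ)}
  {φ : ℝ → (Fin n → ℝ) → (Fin n → ℝ)} {xs x v : Fin n → ℝ} {lam : ℂ}
  {s : (Fin n → ℝ) → ℝ} {B : Set (Fin n → ℝ)}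

theorem IsDominantEigenfunction.im_eq_zero (hs : IsDominantEigenfunction f φ xs B lam v s) :
    lam.im = 0 := by
  obtain ⟨i, hi⟩ := Function.ne_iff.1 hs.pos.ne'
  have h := congrFun hs.eigenvector i
  rw [jacobian_mulVec_ofReal] at h
  have h' := congrArg Complex.im h
  simp only [Complex.ofReal_im, Pi.smul_apply, smul_eq_mul, Complex.im_mul_ofReal] at h'
  exact (mul_eq_zero.1 h'.symm).resolve_right hi

theorem IsDominantEigenfunction.apply_flow_of_nonneg
    (hs : IsDominantEigenfunction f φ xs B lam v s) (hx : x ∈ B) {t : ℝ} (ht : 0 ≤ t) :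
    s (φ t x) = s x * Real.exp (lam.re * t) := by
  have h := hs.eigenfunction.2 t ht x hx
  have hl : lam = (lam.re : ℂ) := Complex.ext rfl (by simp [hs.im_eq_zero])
  rw [hl] at h
  simp only [koopman] at h
  exact_mod_cast h

/-- For negative `t`, the relation at the point `φ t x` with time `-t` is solved for `s (φ t x)`. -/
theorem IsDominantEigenfunction.apply_flow
    (hs : IsDominantEigenfunction f φ xs (basin D φ xs) lam v s) (hφ : IsFlowOn f D φ)
    (hf : ∀ x ∈ D, ContDiffAt ℝ 1 f x) (hx : x ∈ basin D φ xs) (t : ℝ) :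
    s (φ t x) = s x * Real.exp (lam.re * t) := by
  rcases le_total 0 t with ht | ht
  · exact hs.apply_flow_of_nonneg hx ht
  · have h := hs.apply_flow_of_nonneg (flow_mem_basin hφ hf hx t) (neg_nonneg.2 ht)
    rw [hφ.neg_cancel hf hx.1] at h
    rw [h, mul_assoc, ← Real.exp_add]
    simp

/-- If a continuous function has no zero in the punctured cone above `xs` and is positive near `xs`
in one direction of the cone, then it is positive on the punctured cone near `xs`. -/
theorem pos_of_ne_zero_on_cone {b : Fin n → ℝ} {δ : ℝ} (hc : ContinuousOn s (Metric.ball xs δ))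
    (hne : ∀ x ∈ Metric.ball xs δ, xs ≤ x → x ≠ xs → s x ≠ 0)
    (hb : b ∈ Metric.ball xs δ) (hbxs : xs ≤ b) (hbne : b ≠ xs) (hbpos : 0 < s b)
    (hx : x ∈ Metric.ball xs δ) (hxxs : xs ≤ x) (hxne : x ≠ xs) : 0 < s x := by
  by_contra hneg
  have hball : segment ℝ x b ⊆ Metric.ball xs δ := (convex_ball xs δ).segment_subset hx hb
  -- A sum of two nonnegative vectors vanishes only if both do, so the segment misses `xs`.
  have hseg : ∀ y ∈ segment ℝ x b, xs ≤ y ∧ y ≠ xs := by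
    rintro y ⟨p, q, hp, hq, hpq, rfl⟩
    have hd : p • x + q • b - xs = p • (x - xs) + q • (b - xs) := by
      have : xs = (p + q) • xs := by rw [hpq, one_smul]
      nth_rewrite 1 [this]
      module
    have h1 : 0 ≤ p • (x - xs) := smul_nonneg hp (sub_nonneg.2 hxxs)
    have h2 : 0 ≤ q • (b - xs) := smul_nonneg hq (sub_nonneg.2 hbxs)
    refine ⟨sub_nonneg.1 (hd ▸ add_nonneg h1 h2), fun h => ?_⟩
    rw [h, sub_self, eq_comm, add_eq_zero_iff_of_nonneg h1 h2] at hd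
    have hp0 : p = 0 := (smul_eq_zero.1 hd.1).resolve_right (sub_ne_zero.2 hxne)
    have hq0 : q = 0 := (smul_eq_zero.1 hd.2).resolve_right (sub_ne_zero.2 hbne)
    linarith
  obtain ⟨y, hy, hy0⟩ := (convex_segment x b).isPreconnected.intermediate_value
    (left_mem_segment ℝ x b) (right_mem_segment ℝ x b) (hc.mono hball)
    ⟨not_lt.1 hneg, hbpos.le⟩
  exact hne y (hball hy) (hseg y hy).1 (hseg y hy).2 hy0

/-! ### The maximal Lyapunov function of a monotone system -/

/-- The standing facts about a monotone flow near a stable fixed point with an eigenfunction that is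
positive on the punctured cone above it. -/
structure IsMonotoneSystem (f : (Fin n → ℝ) → (Fin n → ℝ)) (D : Set (Fin n → ℝ))
    (φ : ℝ → (Fin n → ℝ) → (Fin n → ℝ)) (xs : Fin n → ℝ) (Q Q' : (Fin n → ℝ) → ℝ) (r α : ℝ)
    (s : (Fin n → ℝ) → ℝ) (l : ℝ) : Prop where
  flow : IsFlowOn f D φ
  isOpen : IsOpen D
  contDiffAt : ∀ x ∈ D, ContDiffAt ℝ 1 f x
  mem : xs ∈ D
  fixed : f xs = 0
  mono : IsMonotoneFlowOn φ (basin D φ xs)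
  lyap : IsLocalLyapunov f D xs Q Q' r α
  l_neg : l < 0
  continuousOn : ContinuousOn s (basin D φ xs)
  zero : s xs = 0
  eigen : ∀ x ∈ basin D φ xs, ∀ t, s (φ t x) = s x * Real.exp (l * t)
  pos : ∀ x ∈ basin D φ xs, xs ≤ x → x ≠ xs → 0 < s x

/-- The time at which the orbit of `x` enters the cone above `xs`. -/
noncomputable def entryTime (φ : ℝ → (Fin n → ℝ) → (Fin n → ℝ)) (xs x : Fin n → ℝ) : ℝ :=
  sInf {t | 0 ≤ t ∧ xs ≤ φ t x}

/-- The eigenfunction corrected by the squared entry time on orbits that enter the cone, and the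
exponential of the hitting time of `{Q ≤ r}` on the other orbits. -/
noncomputable def lyapunovCandidate (φ : ℝ → (Fin n → ℝ) → (Fin n → ℝ)) (xs : Fin n → ℝ)
    (Q : (Fin n → ℝ) → ℝ) (r : ℝ) (s : (Fin n → ℝ) → ℝ) (x : Fin n → ℝ) : ℝ :=
  open Classical in
  if ∃ t, xs ≤ φ t x then s x + entryTime φ xs x ^ 2 else Real.exp (hittingTime φ Q r x)

namespace IsMonotoneSystem

variable {Q Q' : (Fin n → ℝ) → ℝ} {r α l : ℝ}

theorem xs_mem (h : IsMonotoneSystem f D φ xs Q Q' r α s l) : xs ∈ basin D φ xs :=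
  self_mem_basin h.flow h.contDiffAt h.mem h.fixed

/-- Monotonicity against the constant orbit of `xs`, started at the possibly negative time `t`. -/
theorem le_flow_of_le (h : IsMonotoneSystem f D φ xs Q Q' r α s l) (hx : x ∈ basin D φ xs)
    {t u : ℝ} (htu : t ≤ u) (ht : xs ≤ φ t x) : xs ≤ φ u x := by
  have := h.mono (u - t) (sub_nonneg.2 htu) xs h.xs_mem _
    (flow_mem_basin h.flow h.contDiffAt hx t) ht
  rwa [h.flow.fixed h.contDiffAt h.mem h.fixed, h.flow.add h.contDiffAt hx.1,
    sub_add_cancel] at this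

theorem isClosed_entry (h : IsMonotoneSystem f D φ xs Q Q' r α s l) (hx : x ∈ D) :
    IsClosed {t | xs ≤ φ t x} :=
  isClosed_le continuous_const (h.flow.continuous_orbit hx)

theorem entryTime_spec (h : IsMonotoneSystem f D φ xs Q Q' r α s l) (hx : x ∈ basin D φ xs)
    (hex : ∃ t, xs ≤ φ t x) : 0 ≤ entryTime φ xs x ∧ xs ≤ φ (entryTime φ xs x) x := by
  obtain ⟨t, ht⟩ := hex
  have hcl : IsClosed {t | 0 ≤ t ∧ xs ≤ φ t x} := isClosed_Ici.inter (h.isClosed_entry hx.1)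
  exact hcl.csInf_mem ⟨max t 0, le_max_right _ _, h.le_flow_of_le hx (le_max_left _ _) ht⟩
    ⟨0, fun u hu => hu.1⟩

theorem entryTime_of_le (h : IsMonotoneSystem f D φ xs Q Q' r α s l) (hx : x ∈ basin D φ xs)
    (hxs : xs ≤ x) : entryTime φ xs x = 0 := by
  have h0 : xs ≤ φ 0 x := by rwa [h.flow.init x hx.1]
  have : {t | 0 ≤ t ∧ xs ≤ φ t x} = Ici 0 := by
    ext t
    exact ⟨fun ht => ht.1, fun ht => ⟨ht, h.le_flow_of_le hx ht h0⟩⟩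
  rw [entryTime, this, csInf_Ici]

/-- The times spent in the cone form a closed half-line `[t₀, ∞)` or all of `ℝ`. The entry time of
`φ t x` is `max (t₀ - t) 0` in the first case and zero in the second. -/
theorem hasDerivAt_entryTime_sq (h : IsMonotoneSystem f D φ xs Q Q' r α s l)
    (hx : x ∈ basin D φ xs) (hex : ∃ t, xs ≤ φ t x) :
    ∃ d ≤ 0, HasDerivAt (fun t => entryTime φ xs (φ t x) ^ 2) d 0 := by
  have hadd : ∀ t, {u | 0 ≤ u ∧ xs ≤ φ u (φ t x)} = {u | 0 ≤ u ∧ xs ≤ φ (u + t) x} := by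
    intro t
    ext u
    simp [h.flow.add h.contDiffAt hx.1]
  by_cases hb : BddBelow {t | xs ≤ φ t x}
  · set t₀ := sInf {t | xs ≤ φ t x}
    have ht₀ : xs ≤ φ t₀ x := (h.isClosed_entry hx.1).csInf_mem hex hb
    have heq : (fun t => entryTime φ xs (φ t x) ^ 2) = fun t => max (t₀ - t) 0 ^ 2 := by
      ext t
      have hset : {u | 0 ≤ u ∧ xs ≤ φ (u + t) x} = Ici (max (t₀ - t) 0) := by
        ext u
        rw [mem_Ici, max_le_iff]
        refine ⟨fun ⟨hu0, hu⟩ => ⟨?_, hu0⟩, fun ⟨hu, hu0⟩ =>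
          ⟨hu0, h.le_flow_of_le hx (by linarith) ht₀⟩⟩
        have : t₀ ≤ u + t := csInf_le hb hu
        linarith
      rw [entryTime, hadd, hset, csInf_Ici]
    refine ⟨2 * max (t₀ - 0) 0 * -1, ?_, ?_⟩
    · have := le_max_right (t₀ - 0) 0
      linarith
    · rw [heq]
      exact HasDerivAt.comp (0 : ℝ) (hasDerivAt_max_zero_sq (t₀ - 0))
        ((hasDerivAt_id (0 : ℝ)).const_sub t₀)
  · have hall : ∀ t, xs ≤ φ t x := by
      intro t
      obtain ⟨u, hu, hut⟩ := not_bddBelow_iff.1 hb t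
      exact h.le_flow_of_le hx hut.le hu
    have heq : (fun t => entryTime φ xs (φ t x) ^ 2) = fun _ => 0 := by
      ext t
      rw [h.entryTime_of_le (flow_mem_basin h.flow h.contDiffAt hx t) (hall t)]
      norm_num
    exact ⟨0, le_rfl, heq ▸ hasDerivAt_const _ _⟩

theorem hasDerivAt_eigen (h : IsMonotoneSystem f D φ xs Q Q' r α s l) (hx : x ∈ basin D φ xs) :
    HasDerivAt (fun t => s (φ t x)) (s x * l) 0 := by
  have h1 : HasDerivAt (fun t : ℝ => s x * Real.exp (l * t))
      (s x * (Real.exp (l * 0) * (l * 1))) 0 :=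
    (((hasDerivAt_id (0 : ℝ)).const_mul l).exp).const_mul (s x)
  rw [mul_zero, Real.exp_zero, one_mul, mul_one] at h1
  simpa only [h.eigen x hx] using h1

theorem eigen_pos (h : IsMonotoneSystem f D φ xs Q Q' r α s l) (hx : x ∈ basin D φ xs)
    (hne : x ≠ xs) (hex : ∃ t, xs ≤ φ t x) : 0 < s x := by
  obtain ⟨t, ht⟩ := hex
  have h1 := h.pos _ (flow_mem_basin h.flow h.contDiffAt hx t) ht
    (flow_ne h.flow h.contDiffAt h.mem h.fixed hx.1 hne t)
  rw [h.eigen x hx] at h1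
  exact pos_of_mul_pos_left h1 (Real.exp_pos _).le

/-- Each branch of `lyapunovCandidate` is thus used along entire orbits, and its orbital derivative
never crosses between the two formulas. -/
theorem exists_entry_iff (h : IsMonotoneSystem f D φ xs Q Q' r α s l) (hx : x ∈ D) (u : ℝ) :
    (∃ t, xs ≤ φ t (φ u x)) ↔ ∃ t, xs ≤ φ t x := by
  simp only [h.flow.add h.contDiffAt hx]
  exact ⟨fun ⟨t, ht⟩ => ⟨_, ht⟩, fun ⟨t, ht⟩ => ⟨t - u, by rwa [sub_add_cancel]⟩⟩

theorem candidate_of_le (h : IsMonotoneSystem f D φ xs Q Q' r α s l) (hx : x ∈ basin D φ xs)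
    (hxs : xs ≤ x) : lyapunovCandidate φ xs Q r s x = s x := by
  rw [lyapunovCandidate, if_pos ⟨0, by rwa [h.flow.init x hx.1]⟩, h.entryTime_of_le hx hxs]
  ring

theorem candidate_pos (h : IsMonotoneSystem f D φ xs Q Q' r α s l) (hx : x ∈ basin D φ xs)
    (hne : x ≠ xs) : 0 < lyapunovCandidate φ xs Q r s x := by
  rw [lyapunovCandidate]
  split_ifs with hex
  · have := h.eigen_pos hx hne hex
    positivity
  · exact Real.exp_pos _

theorem candidate_deriv (h : IsMonotoneSystem f D φ xs Q Q' r α s l) (hx : x ∈ basin D φ xs) :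
    ∃ d, HasOrbitalDeriv φ (lyapunovCandidate φ xs Q r s) x d ∧ (x ≠ xs → d < 0) := by
  by_cases hex : ∃ t, xs ≤ φ t x
  · obtain ⟨d, hd, hd'⟩ := h.hasDerivAt_entryTime_sq hx hex
    have heq : (fun t => lyapunovCandidate φ xs Q r s (φ t x)) =
        fun t => s (φ t x) + entryTime φ xs (φ t x) ^ 2 := by
      ext t
      rw [lyapunovCandidate, if_pos ((h.exists_entry_iff hx.1 t).2 hex)]
    refine ⟨s x * l + d, ?_, fun hne => ?_⟩
    · rw [HasOrbitalDeriv, heq]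
      exact (h.hasDerivAt_eigen hx).add hd'
    · have := mul_neg_of_pos_of_neg (h.eigen_pos hx hne hex) h.l_neg
      linarith
  · have hne : x ≠ xs := by
      rintro rfl
      exact hex ⟨0, (h.flow.init x hx.1).ge⟩
    have heq : (fun t => lyapunovCandidate φ xs Q r s (φ t x)) =
        fun t => Real.exp (hittingTime φ Q r x - t) := by
      ext t
      rw [lyapunovCandidate, if_neg (mt (h.exists_entry_iff hx.1 t).1 hex),
        h.lyap.hittingTime_flow h.flow h.contDiffAt h.mem h.fixed hx hne]
    refine ⟨Real.exp (hittingTime φ Q r x - 0) * -1, ?_, fun _ => ?_⟩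
    · rw [HasOrbitalDeriv, heq]
      exact ((hasDerivAt_id (0 : ℝ)).const_sub _).exp
    · have := Real.exp_pos (hittingTime φ Q r x - 0)
      linarith

/-- Points of the cone at which the eigenfunction is at most `M` reach `{Q ≤ r}` in uniformly
bounded time. -/
theorem exists_time_of_eigen_le (h : IsMonotoneSystem f D φ xs Q Q' r α s l) (M : ℝ) :
    ∃ T, 0 ≤ T ∧ ∀ x ∈ basin D φ xs, xs ≤ x → s x ≤ M → Q (φ T x) ≤ r := by
  obtain ⟨m, hm0, hm⟩ : ∃ m > 0, ∀ z, Q z = r → xs ≤ z → m ≤ s z := by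
    have hcl : IsClosed {z | Q z = r ∧ xs ≤ z} :=
      (isClosed_eq h.lyap.continuous continuous_const).inter isClosed_Ici
    have hc : IsCompact {z | Q z = r ∧ xs ≤ z} :=
      h.lyap.compact.of_isClosed_subset hcl fun z hz => hz.1.le
    have hsub : {z | Q z = r ∧ xs ≤ z} ⊆ basin D φ xs := fun z hz =>
      h.lyap.sublevel_subset_basin h.flow hz.1.le
    rcases eq_empty_or_nonempty {z | Q z = r ∧ xs ≤ z} with he | hne
    · exact ⟨1, one_pos, fun z hz hz' => (he ▸ (⟨hz, hz'⟩ : z ∈ {z | Q z = r ∧ xs ≤ z}) :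
        z ∈ (∅ : Set (Fin n → ℝ))).elim⟩
    · obtain ⟨z, hz, hmin⟩ := hc.exists_isMinOn hne (h.continuousOn.mono hsub)
      refine ⟨s z, h.pos z (hsub hz) hz.2 ?_, fun y hy hy' => hmin ⟨hy, hy'⟩⟩
      rintro rfl
      have h1 := h.lyap.zero
      have h2 := h.lyap.r_pos
      rw [hz.1] at h1
      exact h2.ne' h1
  -- At a positive hitting time `τ` the orbit is still in the cone, so `m ≤ s x * exp (l * τ)`. With
  -- `s x ≤ M` and `exp (-(l * τ)) > -(l * τ)` this gives `τ < M / m / -l`.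
  refine ⟨max 0 (M / m / -l), le_max_left _ _, fun x hx hxs hM => ?_⟩
  by_cases hne : x = xs
  · rw [hne, h.flow.fixed h.contDiffAt h.mem h.fixed, h.lyap.zero]
    exact h.lyap.r_pos.le
  have hQ := h.lyap.flow_hittingTime h.flow h.contDiffAt h.mem h.fixed hx hne
  set τ := hittingTime φ Q r x
  rcases le_or_gt τ (max 0 (M / m / -l)) with hτ | hτ
  · exact h.lyap.forward_le h.flow hx.1 hτ hQ.le
  exfalso
  have hτ0 : 0 < τ := (le_max_left _ _).trans_lt hτ
  have hτ1 : M / m / -l < τ := (le_max_right _ _).trans_lt hτ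
  have h1 := hm _ hQ (h.le_flow_of_le hx hτ0.le (by rwa [h.flow.init x hx.1]))
  rw [h.eigen x hx] at h1
  have hl := h.l_neg
  have h2 : m * Real.exp (-(l * τ)) ≤ s x := by
    rw [Real.exp_neg, ← div_eq_mul_inv, div_le_iff₀ (Real.exp_pos _)]
    exact h1
  have h3 := mul_lt_mul_of_pos_left
    (Real.add_one_lt_exp (x := -(l * τ)) (by nlinarith [mul_neg_of_neg_of_pos hl hτ0])) hm0
  rw [div_lt_iff₀ (neg_pos.2 hl), div_lt_iff₀ hm0] at hτ1
  nlinarith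

theorem candidate_proper (h : IsMonotoneSystem f D φ xs Q Q' r α s l) (M : ℝ) :
    ∃ C ⊆ basin D φ xs, IsCompact C ∧
      ∀ x ∈ basin D φ xs, lyapunovCandidate φ xs Q r s x ≤ M → x ∈ C := by
  obtain ⟨T, hT0, hT⟩ := h.exists_time_of_eigen_le M
  obtain ⟨C, hCB, hC, hmem⟩ :=
    -- On entering orbits `τ ^ 2 ≤ M` gives `τ ≤ |M| + 1`, and `T` more units lead from the cone to
    -- `{Q ≤ r}`. On the others the hitting time is at most `M - 1`.
    h.lyap.exists_compact h.flow h.isOpen h.contDiffAt (|M| + 1 + T)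
  refine ⟨C, hCB, hC, fun x hx hM => hmem x hx.1 ?_⟩
  have hMabs := le_abs_self M
  rw [lyapunovCandidate] at hM
  split_ifs at hM with hex
  · obtain ⟨hτ0, hτ⟩ := h.entryTime_spec hx hex
    set τ := entryTime φ xs x
    have hs0 : 0 ≤ s x := by
      by_cases hne : x = xs
      · rw [hne, h.zero]
      · exact (h.eigen_pos hx hne hex).le
    have hsM : s (φ τ x) ≤ M := by
      rw [h.eigen x hx]
      have h1 : Real.exp (l * τ) ≤ 1 :=
        Real.exp_le_one_iff.2 (mul_nonpos_of_nonpos_of_nonneg h.l_neg.le hτ0)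
      have h2 := mul_le_of_le_one_right hs0 h1
      nlinarith [sq_nonneg τ]
    have h3 := hT _ (flow_mem_basin h.flow h.contDiffAt hx τ) hτ hsM
    rw [h.flow.add h.contDiffAt hx.1] at h3
    refine h.lyap.forward_le h.flow hx.1 ?_ h3
    nlinarith [sq_nonneg (τ - 1)]
  · have hne : x ≠ xs := by
      rintro rfl
      exact hex ⟨0, (h.flow.init x hx.1).ge⟩
    have h1 := Real.add_one_le_exp (hittingTime φ Q r x)
    exact h.lyap.forward_le h.flow hx.1 (by linarith)
      (h.lyap.flow_hittingTime h.flow h.contDiffAt h.mem h.fixed hx hne).le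

theorem isMaximalLyapunov (h : IsMonotoneSystem f D φ xs Q Q' r α s l) :
    IsMaximalLyapunov φ xs (basin D φ xs)
      (extendTop (basin D φ xs) (lyapunovCandidate φ xs Q r s)) :=
  isMaximalLyapunov_extendTop (h.lyap.isOpen_basin h.flow h.isOpen h.contDiffAt) h.xs_mem
    (fun _ hx t => flow_mem_basin h.flow h.contDiffAt hx t)
    ((h.candidate_of_le h.xs_mem le_rfl).trans h.zero) (fun _ hx hne => h.candidate_pos hx hne)
    h.candidate_proper fun _ hx => h.candidate_deriv hx

end IsMonotoneSystem

/-- A dominant eigenfunction without zeros in the punctured cone above `xs` is positive there. -/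
theorem IsDominantEigenfunction.pos_on_cone
    (hs : IsDominantEigenfunction f φ xs (basin D φ xs) lam v s) (hφ : IsFlowOn f D φ)
    (hf : ∀ x ∈ D, ContDiffAt ℝ 1 f x) (hxs : xs ∈ D) (h0 : f xs = 0)
    (hB : IsOpen (basin D φ xs)) (hmono : IsMonotoneFlowOn φ (basin D φ xs)) (hzero : s xs = 0)
    (hne : ∀ x ∈ basin D φ xs, xs ≤ x → x ≠ xs → s x ≠ 0)
    (hx : x ∈ basin D φ xs) (hle : xs ≤ x) (hxne : x ≠ xs) : 0 < s x := by
  have hmem := self_mem_basin hφ hf hxs h0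
  obtain ⟨δ, hδ, hball⟩ := Metric.isOpen_iff.1 hB xs hmem
  have hdiff : DifferentiableAt ℝ s xs :=
    (hs.contDiffOn.contDiffAt (hB.mem_nhds hmem)).differentiableAt one_ne_zero
  have hline : HasDerivAt (fun ε : ℝ => xs + ε • v) v 0 := by
    simpa using ((hasDerivAt_id (0 : ℝ)).smul_const v).const_add xs
  have hderiv : HasDerivAt (fun ε : ℝ => s (xs + ε • v)) 1 0 := by
    rw [← hs.normalized]
    refine HasFDerivAt.comp_hasDerivAt (0 : ℝ) ?_ hline
    simpa using hdiff.hasFDerivAt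
  obtain ⟨ε, ⟨hεs, hεb⟩, hε⟩ : ∃ ε : ℝ,
      (0 < s (xs + ε • v) ∧ xs + ε • v ∈ Metric.ball xs δ) ∧ 0 < ε := by
    -- The normalization makes the derivative along `v` equal to 1, which supplies the reference
    -- point with `s > 0`.
    have h1 : ∀ᶠ ε in 𝓝[>] (0 : ℝ), 0 < slope (fun ε : ℝ => s (xs + ε • v)) 0 ε :=
      (hderiv.tendsto_slope.mono_left (nhdsWithin_mono _ fun ε hε => ne_of_gt hε)).eventually
        (lt_mem_nhds one_pos)
    have h2 : ∀ᶠ ε in 𝓝[>] (0 : ℝ), xs + ε • v ∈ Metric.ball xs δ := by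
      refine nhdsWithin_le_nhds (hline.continuousAt.eventually ?_)
      refine Metric.isOpen_ball.mem_nhds ?_
      simpa using hδ
    obtain ⟨ε, ⟨h3, h4⟩, hε⟩ := ((h1.and h2).and self_mem_nhdsWithin).exists
    refine ⟨ε, ⟨?_, h4⟩, hε⟩
    rw [slope_def_field] at h3
    simp only [zero_smul, add_zero, hzero, sub_zero] at h3
    exact (div_pos_iff_of_pos_right hε).1 h3
  -- The orbit of `x` reaches the ball without leaving the cone; the sign found there is carried
  -- back by the eigenfunction relation.
  obtain ⟨t, ht, ht0⟩ :=
    ((hx.2.eventually (Metric.ball_mem_nhds xs hδ)).and (eventually_ge_atTop 0)).exists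
  have hle' : xs ≤ φ t x := by
    have := hmono t ht0 xs hmem x hx hle
    rwa [hφ.fixed hf hxs h0] at this
  have hpos := pos_of_ne_zero_on_cone (hs.contDiffOn.continuousOn.mono hball)
    (fun y hy => hne y (hball hy)) hεb (le_add_of_nonneg_right (smul_nonneg hε.le hs.pos.le))
    (by simpa using ⟨hε.ne', hs.pos.ne'⟩) hεs ht hle' (flow_ne hφ hf hxs h0 hx.1 hxne t)
  rw [hs.apply_flow_of_nonneg hx ht0] at hpos
  exact pos_of_mul_pos_left hpos (Real.exp_pos _).le

end MonotoneKoopman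

/-! ### The proposition -/

theorem mainTheorem6 {n : ℕ} (D : Set (Fin n → ℝ)) (hD : IsOpen D)
    (f : (Fin n → ℝ) → (Fin n → ℝ)) (hf : ContDiffOn ℝ 2 f D)
    (φ : ℝ → (Fin n → ℝ) → (Fin n → ℝ)) (hφ : IsFlowOn f D φ)
    (xs : Fin n → ℝ) (hxs : xs ∈ D) (hstable : IsStableHyperbolic f xs)
    (hdiag : IsDiagonalizable (jacobian f xs))
    (hmono : IsMonotoneFlowOn φ (basin D φ xs))
    (lam₁ : ℂ) (v₁ : Fin n → ℝ) (s₁ : (Fin n → ℝ) → ℝ)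
    (hs₁ : IsDominantEigenfunction f φ xs (basin D φ xs) lam₁ v₁ s₁)
    (hiso : isostable s₁ (basin D φ xs) 0 ∩ ({xs} + {z : Fin n → ℝ | 0 ≤ z}) = {xs}) :
    IsLyapunovOn φ xs (({xs} + {z : Fin n → ℝ | 0 ≤ z}) ∩ basin D φ xs) s₁ ∧
      ∃ V : (Fin n → ℝ) → EReal,
        (∀ x ∈ ({xs} + {z : Fin n → ℝ | 0 ≤ z}) ∩ basin D φ xs, V x = (s₁ x : EReal)) ∧
        IsMaximalLyapunov φ xs (basin D φ xs) V := by
  have hf' : ∀ x ∈ D, ContDiffAt ℝ 1 f x := fun x hx =>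
    (hf.contDiffAt (hD.mem_nhds hx)).of_le (by norm_num)
  have hcone : {xs} + {z : Fin n → ℝ | 0 ≤ z} = Ici xs := by
    ext x
    simp only [singleton_add, mem_image, mem_ofPred_eq, mem_Ici]
    exact ⟨fun ⟨z, hz, h⟩ => h ▸ le_add_of_nonneg_right hz,
      fun h => ⟨x - xs, sub_nonneg.2 h, by simp⟩⟩
  rw [hcone] at hiso ⊢
  obtain ⟨Q, Q', r, α, hQ⟩ :=
    exists_isLocalLyapunov hD hxs ((hf' xs hxs).differentiableAt one_ne_zero) hstable hdiag
  have hB := hQ.isOpen_basin hφ hD hf'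
  have hzero : s₁ xs = 0 := by
    have h : xs ∈ isostable s₁ (basin D φ xs) 0 ∩ Ici xs := hiso ▸ mem_singleton xs
    exact abs_eq_zero.1 h.1.2
  have hne : ∀ x ∈ basin D φ xs, xs ≤ x → x ≠ xs → s₁ x ≠ 0 := by
    intro x hx hle hxne h
    have : x ∈ isostable s₁ (basin D φ xs) 0 ∩ Ici xs := ⟨⟨hx, by rw [h, abs_zero]⟩, hle⟩
    rw [hiso] at this
    exact hxne this
  have h : IsMonotoneSystem f D φ xs Q Q' r α s₁ lam₁.re :=
    { flow := hφ
      isOpen := hD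
      contDiffAt := hf'
      mem := hxs
      fixed := hstable.1
      mono := hmono
      lyap := hQ
      l_neg := hstable.2 _ hs₁.dominant.1
      continuousOn := hs₁.contDiffOn.continuousOn
      zero := hzero
      eigen := fun x hx t => hs₁.apply_flow hφ hf' hx t
      pos := fun x hx hle hxne =>
        hs₁.pos_on_cone hφ hf' hxs hstable.1 hB hmono hzero hne hx hle hxne }
  refine ⟨⟨hs₁.contDiffOn.mono inter_subset_right, hzero, fun x hx hxne => h.pos x hx.2 hx.1 hxne,
    fun x hx hxne => ⟨s₁ x * lam₁.re, h.hasDerivAt_eigen hx.2,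
      mul_neg_of_pos_of_neg (h.pos x hx.2 hx.1 hxne) h.l_neg⟩⟩, _, fun x hx => ?_,
    h.isMaximalLyapunov⟩
  rw [extendTop_of_mem _ hx.2, h.candidate_of_le hx.2 hx.1]
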